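/- Let $L \ge 1$ be a real number and $N \in \mathbb{N}$. There is a constant $\lambda = \lambda(L,N) \ge 1$, depending only on $L$ and $N$, with the following property. Let $(X,d)$ be a complete metric space such that - $X$ is $L$-linearly connected: for all $x, y \in X$ there is a compact connected set $K \subseteq X$ containing $x$ and $y$ with $\operatorname{diam} K \le L\, d(x,y)$; - $X$ is $N$-doubling: every open ball of radius $r>0$ in $X$ can be covered by at most $N$ open balls of radius $r/2$. Then any two distinct points $a, b \in X$ are the endpoints of a $\lambda$-quasi-arc, that is, of an arc $J \subseteq X$ (a homeomorphic image of $[0,1]$) such that $$\operatorname{diam} J[x,y] \le \lambda\, d(x,y) \quad\text{for all } x, y \in J,$$ where $J[x,y]$ denotes the closed (possibly trivial) subarc of $J$ lying between $x$ and $y$. -/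

import Mathlib

/-- `X` is `N`-doubling: every ball can be covered by at most `N` balls of half the radius. -/
def IsMetricDoubling (N : ℕ) (X : Type*) [MetricSpace X] : Prop :=
  ∀ (x : X) (r : ℝ), 0 < r → ∃ s : Finset X, s.card ≤ N ∧
    Metric.ball x r ⊆ ⋃ c ∈ s, Metric.ball c (r / 2)

/-- `X` is `L`-linearly connected: any two points lie in a compact connected set of diameter
at most `L` times their distance. -/
def IsLinearlyConnected (L : ℝ) (X : Type*) [MetricSpace X] : Prop :=
  ∀ x y : X, ∃ J : Set X, IsCompact J ∧ IsConnected J ∧ x ∈ J ∧ y ∈ J ∧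
    Metric.diam J ≤ L * dist x y

/-- An arc in `X`, presented by a topological embedding of the closed unit interval. -/
structure EmbeddedArc (X : Type*) [TopologicalSpace X] where
  param : unitInterval → X
  isEmbedding : Topology.IsEmbedding param

namespace EmbeddedArc

/-- The underlying set of an arc. -/
def carrier {X : Type*} [TopologicalSpace X] (A : EmbeddedArc X) : Set X :=
  Set.range A.param

/-- For `x`, `y` on the arc `A`, the closed (possibly trivial) subarc `A[x, y]` of `A` lying
between them, that is, the image of the closed parameter interval whose ends are the parameters
of `x` and of `y` (in either order). The parameters are unique, `A.param` being injective, and the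
set does not depend on the chosen parametrization of the arc. -/
def subarc {X : Type*} [TopologicalSpace X] (A : EmbeddedArc X) (x y : X) : Set X :=
  {z | ∃ s t u : unitInterval, A.param s = x ∧ A.param t = y ∧ u ∈ Set.uIcc s t ∧ A.param u = z}

/-- The arc `A` joins `a` to `b`: these are its endpoints. -/
def Joins {X : Type*} [TopologicalSpace X] (A : EmbeddedArc X) (a b : X) : Prop :=
  A.param 0 = a ∧ A.param 1 = b

/-- The arc `A` is a `lam`-quasi-arc: `diam A[x, y] ≤ lam * d(x, y)` for all `x`, `y` on `A`. -/
def IsQuasiArc {X : Type*} [MetricSpace X] (lam : ℝ) (A : EmbeddedArc X) : Prop :=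
  ∀ x ∈ A.carrier, ∀ y ∈ A.carrier, Metric.diam (A.subarc x y) ≤ lam * dist x y

end EmbeddedArc

namespace QuasiArc

open Set Metric

universe u

/-! The arc is a limit of chains of tiles. At every scale `ε`, `exists_tiling` covers the space by
connected sets of size at most `ε`, any two of which either meet or are at least `δ * ε` apart, with
`δ` depending only on `L` and `N`. This gap makes metric closeness a combinatorial matter: tiles
containing sufficiently close points must meet.

Join `a` to `b` by a simple chain of tiles, one in which only consecutive tiles meet.
Non-consecutive tiles are then `δ * ε` apart, so a simple chain of much smaller tiles can follow the
first without doubling back between distant tiles (`IsTiling.exists_refinement`). Iterating along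
the scales `ρ ^ n * ε` gives a tower of chains.

The chains subdivide `[0, 1]` compatibly (`exists_index`), and choosing points in the tiles yields a
limit map. If two of its points are closer than about `δ * ρ ^ n * ε`, their tiles of level `n`
coincide or are consecutive, so the subarc between them stays within a few tiles of that level. This
gives injectivity and bounded turning at once (`exists_limit_arc`). -/

/-! ### Separated sets in doubling spaces -/

theorem exists_finset_cover {X : Type*} [MetricSpace X] {N : ℕ} (hN : IsMetricDoubling N X)
    (k : ℕ) (x : X) {R : ℝ} (hR : 0 < R) :
    ∃ s : Finset X, s.card ≤ N ^ k ∧ ball x R ⊆ ⋃ c ∈ s, ball c (R / 2 ^ k) := by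
  classical
  induction k with
  | zero => exact ⟨{x}, by simp, by simp⟩
  | succ k ih =>
    obtain ⟨s, hs, hc⟩ := ih
    choose t ht htc using fun c : X => hN c (R / 2 ^ k) (by positivity)
    refine ⟨s.biUnion t, ?_, ?_⟩
    · calc (s.biUnion t).card ≤ s.card * N := Finset.card_biUnion_le_card_mul _ _ _ fun c _ => ht c
        _ ≤ N ^ k * N := Nat.mul_le_mul_right _ hs
        _ = N ^ (k + 1) := (pow_succ _ _).symm
    · intro y hy
      obtain ⟨c, hcs, hyc⟩ := mem_iUnion₂.1 (hc hy)
      obtain ⟨e, he, hye⟩ := mem_iUnion₂.1 (htc c hyc)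
      refine mem_iUnion₂.2 ⟨e, Finset.mem_biUnion.2 ⟨c, hcs, he⟩, ?_⟩
      rwa [pow_succ, ← div_div]

/-- Two distinct points of `S` cannot share a covering ball, since its radius `R / 2 ^ k` is at most
`r / 2`. -/
theorem finite_of_separated {X : Type*} [MetricSpace X] {N : ℕ} (hN : IsMetricDoubling N X)
    {k : ℕ} {x : X} {R r : ℝ} (hR : 0 < R) (hk : 2 * R ≤ 2 ^ k * r) {S : Set X}
    (hS : S ⊆ ball x R) (hsep : S.Pairwise fun u v => r ≤ dist u v) :
    S.Finite ∧ S.ncard ≤ N ^ k := by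
  obtain ⟨s, hs, hc⟩ := exists_finset_cover hN k x hR
  have h : ∀ y ∈ S, ∃ c ∈ s, y ∈ ball c (R / 2 ^ k) := fun y hy => by
    simpa using hc (hS hy)
  choose! f hfs hf using h
  have hinj : InjOn f S := by
    intro y hy z hz hyz
    by_contra hne
    have h1 := hsep hy hz hne
    have h2 := hf y hy
    have h3 := hf z hz
    rw [← hyz] at h3
    have h4 := dist_triangle_right y z (f y)
    have h5 : 2 * (R / 2 ^ k) ≤ r := by
      rw [mul_div_assoc', div_le_iff₀ (by positivity)]
      linarith
    rw [mem_ball] at h2 h3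
    linarith
  have hmaps : MapsTo f S (s : Set X) := fun y hy => hfs y hy
  refine ⟨Finite.of_injOn hmaps hinj s.finite_toSet, ?_⟩
  calc S.ncard ≤ (s : Set X).ncard := ncard_le_ncard_of_injOn f hmaps hinj s.finite_toSet
    _ = s.card := ncard_coe_finset s
    _ ≤ N ^ k := hs

theorem exists_maximal_separated {X : Type*} [MetricSpace X] {D : ℝ} (hD : 0 < D) (R : Set X) :
    ∃ A ⊆ R, (A.Pairwise fun u v => D ≤ dist u v) ∧ ∀ x ∈ R, ∃ a ∈ A, dist x a < D := by
  obtain ⟨A, hA⟩ := zorn_subset {A : Set X | A ⊆ R ∧ A.Pairwise fun u v => D ≤ dist u v} (by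
    intro c hc hch
    refine ⟨⋃₀ c, ⟨sUnion_subset fun s hs => (hc hs).1, ?_⟩, fun s hs => subset_sUnion_of_mem hs⟩
    exact (pairwise_sUnion hch.directedOn).2 fun s hs => (hc hs).2)
  refine ⟨A, hA.prop.1, hA.prop.2, fun x hx => ?_⟩
  by_contra! hcon
  have hmem : x ∈ A := by
    refine hA.le_of_ge (y := insert x A) ⟨insert_subset hx hA.prop.1, ?_⟩ (subset_insert _ _)
      (mem_insert _ _)
    exact hA.prop.2.insert fun b hb _ => ⟨hcon b hb, by rw [dist_comm]; exact hcon b hb⟩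
  have := hcon x hmem
  rw [dist_self] at this
  linarith

/-- Each layer is a maximal `D`-separated subset of what the `r`-balls about earlier layers leave
uncovered. A point missed by layers `0, …, M` would have, by maximality, a point of each within `D`;
these `M + 1` points are `r`-separated, which is too many. Layers let sets far apart be enlarged
simultaneously. -/
theorem exists_layers {X : Type*} [MetricSpace X] {D r : ℝ} (hr : 0 < r) (hD : 0 < D) {M : ℕ}
    (hM : ∀ (x : X) (S : Set X), S ⊆ ball x D → (S.Pairwise fun u v => r ≤ dist u v) →
      S.Finite ∧ S.ncard ≤ M) :
    ∃ A : ℕ → Set X, (∀ k, (A k).Pairwise fun u v => D ≤ dist u v) ∧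
      (∀ i j, i < j → ∀ x ∈ A i, ∀ y ∈ A j, r ≤ dist x y) ∧
      ∀ x, ∃ i ≤ M, ∃ a ∈ A i, dist x a < r := by
  choose m hmR hms hmd using fun R : Set X => exists_maximal_separated hD R
  let R : ℕ → Set X := fun k => Nat.rec univ (fun _ R => R \ ⋃ a ∈ m R, ball a r) k
  have hRs : ∀ k, R (k + 1) = R k \ ⋃ a ∈ m (R k), ball a r := fun k => rfl
  have hanti : Antitone R := antitone_nat_of_succ_le fun k => by rw [hRs]; exact sdiff_subset
  have hfar : ∀ i j, i < j → ∀ x ∈ m (R i), ∀ y ∈ R j, r ≤ dist x y := by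
    intro i j hij x hx y hy
    have h1 := hanti (Nat.succ_le_of_lt hij) hy
    rw [Nat.succ_eq_add_one, hRs] at h1
    by_contra! hlt
    exact h1.2 (mem_iUnion₂.2 ⟨x, hx, by rwa [mem_ball, dist_comm]⟩)
  refine ⟨fun k => m (R k), fun k => hms _, fun i j hij x hx y hy => hfar i j hij x hx y
    (hmR _ hy), fun x => ?_⟩
  by_contra! hcon
  have hx : ∀ k ≤ M, x ∈ R k := by
    intro k
    induction k with
    | zero => exact fun _ => mem_univ x
    | succ k ih =>
      intro hk
      rw [hRs]
      refine ⟨ih (by omega), fun h => ?_⟩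
      obtain ⟨a, ha, hxa⟩ := mem_iUnion₂.1 h
      exact absurd hxa (not_lt.2 (hcon k (by omega) a ha))
  have h : ∀ k ≤ M, ∃ a ∈ m (R k), dist x a < D := fun k hk => hmd _ x (hx k hk)
  have : Nonempty X := ⟨x⟩
  choose! a ha had using h
  have hsep : ∀ i ≤ M, ∀ j ≤ M, i ≠ j → r ≤ dist (a i) (a j) := by
    intro i hi j hj hij
    rcases lt_or_gt_of_ne hij with h | h
    · exact hfar i j h _ (ha i hi) _ (hmR _ (ha j hj))
    · rw [dist_comm]
      exact hfar j i h _ (ha j hj) _ (hmR _ (ha i hi))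
  have hinj : InjOn a (Iic M) := by
    intro i hi j hj hij
    by_contra hne
    have := hsep i hi j hj hne
    rw [hij, dist_self] at this
    linarith
  have hcard := (hM x (a '' Iic M) (by
    rintro _ ⟨i, hi, rfl⟩
    rw [mem_ball, dist_comm]
    exact had i hi) (by
    rintro _ ⟨i, hi, rfl⟩ _ ⟨j, hj, rfl⟩ hne
    exact hsep i hi j hj fun h => hne (h ▸ rfl))).2
  rw [hinj.ncard_image, ← Finset.coe_Iic, ncard_coe_finset, Nat.card_Iic] at hcard
  omega

/-! ### Tilings by connected sets -/

/-- An antitone sequence of finite sets with at most `M` elements is stationary at some step. -/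
theorem exists_stationary {α : Type*} {S : ℕ → Set α} (hS : Antitone S) {M : ℕ}
    (hfin : (S 0).Finite) (hM : (S 0).ncard ≤ M) : ∃ l ≤ M, S (l + 1) = S l := by
  by_contra! hcon
  have h : ∀ l ≤ M + 1, (S l).ncard + l ≤ M := by
    intro l
    induction l with
    | zero => intro _; simpa using hM
    | succ l ih =>
      intro hl
      have h1 := ih (by omega)
      have h2 := ncard_lt_ncard ((hS (Nat.le_succ l)).ssubset_of_ne (hcon l (by omega)))
        (hfin.subset (hS (Nat.zero_le l)))
      rw [Nat.succ_eq_add_one] at h2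
      omega
  have := h (M + 1) le_rfl
  omega

theorem isConnected_union_biUnion {X : Type*} [TopologicalSpace X] {ι : Type*} {V : Set X}
    (hV : IsConnected V) {S : Set ι} {K : ι → Set X} (hK : ∀ i ∈ S, IsPreconnected (K i))
    (hVK : ∀ i ∈ S, (V ∩ K i).Nonempty) : IsConnected (V ∪ ⋃ i ∈ S, K i) := by
  obtain ⟨x, hx⟩ := hV.nonempty
  refine ⟨⟨x, Or.inl hx⟩, isPreconnected_of_forall x ?_⟩
  rintro y (hy | hy)
  · exact ⟨V, subset_union_left, hx, hy, hV.isPreconnected⟩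
  · obtain ⟨i, hi, hyi⟩ := mem_iUnion₂.1 hy
    obtain ⟨z, hzV, hzK⟩ := hVK i hi
    exact ⟨V ∪ K i, union_subset_union_right _ (subset_biUnion_of_mem hi), Or.inl hx, Or.inr hyi,
      hV.isPreconnected.union z hzV hzK (hK i hi)⟩

theorem exists_connected_of_dist {L : ℝ} {X : Type*} [MetricSpace X]
    (hX : IsLinearlyConnected L X) (x y : X) :
    ∃ K : Set X, IsConnected K ∧ x ∈ K ∧ y ∈ K ∧ ∀ u ∈ K, ∀ v ∈ K, dist u v ≤ L * dist x y := by
  obtain ⟨K, hc, hK, hx, hy, hd⟩ := hX x y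
  exact ⟨K, hK, hx, hy, fun u hu v hv => (dist_le_diam_of_mem hc.isBounded hu hv).trans hd⟩

/-- A connected set can be slightly enlarged so as to meet each member of a given family that comes
too close to it. -/
theorem exists_expansion {L : ℝ} (hL : 1 ≤ L) {X : Type*} [MetricSpace X]
    (hX : IsLinearlyConnected L X) {W : Set X} (hW : IsConnected W) {I : Set X} (V : X → Set X)
    {τ : ℝ} (hτ : 0 < τ) {M : ℕ}
    (hfin : {y ∈ I | ∃ u ∈ W, ∃ v ∈ V y, dist u v < τ}.Finite)
    (hM : {y ∈ I | ∃ u ∈ W, ∃ v ∈ V y, dist u v < τ}.ncard ≤ M) :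
    ∃ W' : Set X, W ⊆ W' ∧ IsConnected W' ∧ (∀ z ∈ W', ∃ u ∈ W, dist z u ≤ τ / 8) ∧
      ∀ y ∈ I, Disjoint W' (V y) → ∀ u ∈ W', ∀ v ∈ V y, (8 * L)⁻¹ ^ (M + 1) * τ ≤ dist u v := by
  set q : ℝ := (8 * L)⁻¹ with hq
  have hq0 : 0 < q := by positivity
  have hq1 : q ≤ 1 / 8 := by
    rw [hq, inv_le_comm₀ (by positivity) (by norm_num)]
    linarith
  have hLq : L * q = 1 / 8 := by
    rw [hq]
    field_simp
  let S : ℕ → Set X := fun l => {y ∈ I | ∃ u ∈ W, ∃ v ∈ V y, dist u v < q ^ l * τ}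
  have hmono : ∀ i j, i ≤ j → q ^ j * τ ≤ q ^ i * τ := fun i j hij =>
    mul_le_mul_of_nonneg_right (pow_le_pow_of_le_one hq0.le (by linarith) hij) hτ.le
  have hS : Antitone S := by
    rintro i j hij y ⟨hy, u, hu, v, hv, huv⟩
    exact ⟨hy, u, hu, v, hv, huv.trans_le (hmono i j hij)⟩
  -- By pigeonhole some scale gap is empty: no `V y` has its distance from `W` between `q ^ (l + 1)
  -- * τ` and `q ^ l * τ`. Nearer sets are joined to `W` by connectors of size `q ^ l * τ / 8`, too
  -- short to spoil the distance to the others.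
  obtain ⟨l, hl, hSl⟩ := exists_stationary hS (M := M) (by simpa [S] using hfin)
    (by simpa [S] using hM)
  have hK : ∀ y ∈ S (l + 1), ∃ K : Set X, IsConnected K ∧ (W ∩ K).Nonempty ∧ (V y ∩ K).Nonempty ∧
      ∀ u ∈ K, ∀ v ∈ K, dist u v ≤ q ^ l * τ / 8 := by
    rintro y ⟨-, u, hu, v, hv, huv⟩
    obtain ⟨K, hK, huK, hvK, hd⟩ := exists_connected_of_dist hX u v
    refine ⟨K, hK, ⟨u, hu, huK⟩, ⟨v, hv, hvK⟩, fun a ha b hb => (hd a ha b hb).trans ?_⟩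
    calc L * dist u v ≤ L * (q ^ (l + 1) * τ) := by gcongr
      _ = (L * q) * (q ^ l * τ) := by ring
      _ = q ^ l * τ / 8 := by rw [hLq]; ring
  choose! K hKc hKW hKV hKd using hK
  have hnear : ∀ z ∈ W ∪ ⋃ y ∈ S (l + 1), K y, ∃ u ∈ W, dist z u ≤ q ^ l * τ / 8 := by
    rintro z (hz | hz)
    · exact ⟨z, hz, by rw [dist_self]; positivity⟩
    · obtain ⟨y, hy, hzy⟩ := mem_iUnion₂.1 hz
      obtain ⟨u, huW, huK⟩ := hKW y hy
      exact ⟨u, huW, hKd y hy z hzy u huK⟩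
  refine ⟨W ∪ ⋃ y ∈ S (l + 1), K y, subset_union_left,
    isConnected_union_biUnion hW (fun y hy => (hKc y hy).isPreconnected) hKW, ?_, ?_⟩
  · intro z hz
    obtain ⟨u, hu, hzu⟩ := hnear z hz
    have := hmono 0 l (Nat.zero_le l)
    exact ⟨u, hu, by linarith [pow_zero q]⟩
  · intro y hy hdisj z hz v hv
    have hyS : y ∉ S l := by
      rw [← hSl]
      intro hyS
      obtain ⟨w, hwV, hwK⟩ := hKV y hyS
      exact hdisj.le_bot ⟨Or.inr (mem_iUnion₂.2 ⟨y, hyS, hwK⟩), hwV⟩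
    obtain ⟨u, hu, hzu⟩ := hnear z hz
    have h1 : q ^ l * τ ≤ dist u v := by
      by_contra! h
      exact hyS ⟨hy, u, hu, v, hv, h⟩
    have h2 := dist_triangle_left u v z
    have h3 := hmono (l + 1) (M + 1) (by omega)
    have h4 : q ^ (l + 1) * τ ≤ q ^ l * τ * (1 / 8) := by
      rw [pow_succ, mul_right_comm]
      gcongr
    have h5 : 0 < q ^ l * τ := by positivity
    linarith

/-- A cover by connected sets of size at most `ε`, any two of which meet or are `δ * ε` apart. -/
structure IsTiling {X : Type*} [MetricSpace X] (ε δ : ℝ) (T : Set (Set X)) : Prop where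
  exists_mem : ∀ x, ∃ V ∈ T, x ∈ V
  isConnected : ∀ V ∈ T, IsConnected V
  dist_le : ∀ V ∈ T, ∀ x ∈ V, ∀ y ∈ V, dist x y ≤ ε
  le_dist : ∀ V ∈ T, ∀ W ∈ T, Disjoint V W → ∀ x ∈ V, ∀ y ∈ W, δ * ε ≤ dist x y

/-- Only the sets of one layer `A` are expanded. Two of them start `2 * τ` apart and move by at most
`τ / 8`, so they stay apart; against an unexpanded set the bound is that of `exists_expansion`. -/
theorem exists_tiling_step {L : ℝ} (hL : 1 ≤ L) {X : Type*} [MetricSpace X]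
    (hX : IsLinearlyConnected L X) {I A : Set X} (hA : A ⊆ I) {V : X → Set X}
    (hV : ∀ x ∈ I, IsConnected (V x)) {τ : ℝ} (hτ : 0 < τ) {M : ℕ}
    (hM : ∀ x ∈ A, {y ∈ I | ∃ u ∈ V x, ∃ v ∈ V y, dist u v < τ}.Finite ∧
      {y ∈ I | ∃ u ∈ V x, ∃ v ∈ V y, dist u v < τ}.ncard ≤ M)
    (hAA : ∀ x ∈ A, ∀ y ∈ A, x ≠ y → ∀ u ∈ V x, ∀ v ∈ V y, 2 * τ ≤ dist u v) :
    ∃ V' : X → Set X, (∀ x, V x ⊆ V' x) ∧ (∀ x, ∀ z ∈ V' x, ∃ u ∈ V x, dist z u ≤ τ / 8) ∧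
      (∀ x ∈ I, IsConnected (V' x)) ∧
      ∀ x ∈ A, ∀ y ∈ I, Disjoint (V' x) (V' y) → ∀ u ∈ V' x, ∀ v ∈ V' y,
        (8 * L)⁻¹ ^ (M + 1) * τ ≤ dist u v := by
  classical
  have h := fun x (hx : x ∈ A) => exists_expansion hL hX (hV x (hA hx)) V hτ (hM x hx).1 (hM x hx).2
  choose! W hVW hWc hWd hWs using h
  have hnear : ∀ x, ∀ z ∈ (if x ∈ A then W x else V x), ∃ u ∈ V x, dist z u ≤ τ / 8 := by
    intro x z hz
    split_ifs at hz with hx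
    · exact hWd x hx z hz
    · exact ⟨z, hz, by rw [dist_self]; positivity⟩
  refine ⟨fun x => if x ∈ A then W x else V x, fun x => ?_, hnear, fun x hx => ?_, ?_⟩
  · dsimp only
    split_ifs with hx
    exacts [hVW x hx, subset_rfl]
  · dsimp only
    split_ifs with hxA
    exacts [hWc x hxA, hV x hx]
  · intro x hx y hy hdisj u hu v hv
    by_cases hyA : y ∈ A
    · have hxy : x ≠ y := by
        rintro rfl
        exact hdisj.le_bot ⟨hu, hu⟩
      obtain ⟨u', hu', huu⟩ := hnear x u hu
      obtain ⟨v', hv', hvv⟩ := hnear y v hv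
      have h1 := hAA x hx y hyA hxy u' hu' v' hv'
      have h2 := dist_triangle4 u' u v v'
      rw [dist_comm u' u] at h2
      have h3 : (8 * L)⁻¹ ^ (M + 1) * τ ≤ 1 * τ := by
        gcongr
        exact pow_le_one₀ (by positivity) (inv_le_one_of_one_le₀ (by linarith))
      linarith
    · simp only [hx, hyA, if_true, if_false] at hdisj hu hv
      exact hWs x hx y hy hdisj u hu v hv

/-- The layers are expanded one after another, at scales shrinking by `κ`, so that later expansions
are too small to destroy earlier gaps. The number of layers is bounded in terms of `L` and `N`,
hence so is the total loss. -/
theorem exists_tiling (L : ℝ) (hL : 1 ≤ L) (N : ℕ) :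
    ∃ δ : ℝ, 0 < δ ∧ δ ≤ 1 ∧ ∀ (X : Type u) [MetricSpace X],
      IsLinearlyConnected L X → IsMetricDoubling N X → ∀ ε : ℝ, 0 < ε →
        ∃ T : Set (Set X), IsTiling ε δ T := by
  obtain ⟨k, hk⟩ := pow_unbounded_of_one_lt (12 * L) (one_lt_two : (1 : ℝ) < 2)
  set M := N ^ k with hMdef
  set κ : ℝ := (8 * L)⁻¹ ^ (M + 1) with hκ
  have hκ0 : 0 < κ := by positivity
  have hκ1 : κ ≤ 1 / 8 := by
    have h1 : (8 * L)⁻¹ ≤ 1 / 8 := by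
      rw [inv_le_comm₀ (by positivity) (by norm_num)]
      linarith
    calc κ ≤ (8 * L)⁻¹ ^ 1 := pow_le_pow_of_le_one (by positivity) (by linarith) (by omega)
      _ ≤ 1 / 8 := by rwa [pow_one]
  refine ⟨κ ^ (M + 1) / 4, by positivity, ?_, ?_⟩
  · have := pow_le_one₀ (n := M + 1) hκ0.le (by linarith)
    linarith
  intro X _ hX hN ε hε
  obtain ⟨r, hr, hrε⟩ : ∃ r : ℝ, 0 < r ∧ ε = 4 * (L * r) :=
    ⟨ε / (4 * L), by positivity, by field_simp⟩
  have hLr : 0 < L * r := by positivity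
  have hM : ∀ (x : X) (S : Set X), S ⊆ ball x (6 * (L * r)) →
      (S.Pairwise fun u v => r ≤ dist u v) → S.Finite ∧ S.ncard ≤ M := fun x S hS hsep =>
    finite_of_separated hN (by positivity) (by nlinarith) hS hsep
  obtain ⟨A, hA, hAr, hcov⟩ := exists_layers hr (by positivity) hM
  let I : Set X := {x | ∃ i ≤ M, x ∈ A i}
  have hI : I.Pairwise fun u v => r ≤ dist u v := by
    rintro x ⟨i, -, hi⟩ y ⟨j, -, hj⟩ hne
    rcases lt_trichotomy i j with h | rfl | h
    · exact hAr i j h x hi y hj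
    · exact le_trans (by nlinarith) (hA i hi hj hne)
    · rw [dist_comm]
      exact hAr j i h y hj x hi
  -- The radius starts at `L * r`, and the reserve `κ ^ j * (L * r)` pays for later expansions,
  -- keeping it below `2 * (L * r)`. Hence layer mates, with centres `6 * (L * r)` apart, remain `2
  -- * (L * r)` apart, and sets that are close have centres within `6 * (L * r)`.
  have key : ∀ j ≤ M + 1, ∃ V : X → Set X, (∀ x ∈ I, IsConnected (V x)) ∧
      (∀ x, ball x r ⊆ V x) ∧ (∀ x, ∀ z ∈ V x, dist z x ≤ 2 * (L * r) - κ ^ j * (L * r)) ∧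
      ∀ i < j, ∀ x ∈ A i, ∀ y ∈ I, Disjoint (V x) (V y) → ∀ u ∈ V x, ∀ v ∈ V y,
        κ ^ j * (L * r) ≤ dist u v := by
    intro j
    induction j with
    | zero =>
      intro _
      choose K hK hxK hyK hd using fun x y : X => exists_connected_of_dist hX x y
      refine ⟨fun x => {x} ∪ ⋃ y ∈ ball x r, K x y, fun x _ => isConnected_union_biUnion
        isConnected_singleton (fun y _ => (hK x y).isPreconnected) fun y _ => ⟨x, rfl, hxK x y⟩,
        fun x y hy => Or.inr (mem_iUnion₂.2 ⟨y, hy, hyK x y⟩), ?_, by simp⟩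
      rintro x z (hz | hz)
      · rw [mem_singleton_iff.1 hz, dist_self]
        linarith
      · obtain ⟨y, hy, hz⟩ := mem_iUnion₂.1 hz
        rw [mem_ball, dist_comm] at hy
        have h1 := hd x y z hz x (hxK x y)
        have h2 : L * dist x y ≤ L * r := by gcongr
        linarith
    | succ j ih =>
      intro hj
      obtain ⟨V, hVc, hVb, hVd, hVs⟩ := ih (by omega)
      set τ := κ ^ j * (L * r) with hτdef
      have hτ : 0 < τ := by positivity
      have hτL : τ ≤ L * r := by
        have := pow_le_one₀ (n := j) hκ0.le (by linarith)
        nlinarith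
      have hτ' : κ ^ (j + 1) * (L * r) = κ * τ := by rw [hτdef]; ring
      have hκτ : κ * τ ≤ τ / 8 := by nlinarith
      obtain ⟨V', hVV, hnear, hconn, hsep⟩ := exists_tiling_step hL hX (I := I) (A := A j)
        (fun x hx => ⟨j, by omega, hx⟩) hVc hτ (M := M) (by
          intro x hx
          refine hM x _ ?_ (hI.mono fun y hy => hy.1)
          rintro y ⟨-, u, hu, v, hv, huv⟩
          have h1 := hVd x u hu
          have h2 := hVd y v hv
          have h3 := dist_triangle4 y v u x
          rw [dist_comm y v, dist_comm v u] at h3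
          rw [mem_ball]
          linarith) (by
          intro x hx y hy hne u hu v hv
          have h1 := hVd x u hu
          have h2 := hVd y v hv
          have h3 := hA j hx hy hne
          have h4 := dist_triangle4 x u v y
          rw [dist_comm x u] at h4
          linarith)
      rw [hτ']
      refine ⟨V', hconn, fun x => (hVb x).trans (hVV x), fun x z hz => ?_, ?_⟩
      · obtain ⟨u, hu, hzu⟩ := hnear x z hz
        have h1 := hVd x u hu
        have h2 := dist_triangle z u x
        linarith
      · intro i hi x hx y hy hdisj u hu v hv
        rcases Nat.lt_succ_iff_lt_or_eq.1 hi with h | rfl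
        · obtain ⟨u', hu', huu⟩ := hnear x u hu
          obtain ⟨v', hv', hvv⟩ := hnear y v hv
          have h1 := hVs i h x hx y hy (hdisj.mono (hVV x) (hVV y)) u' hu' v' hv'
          have h2 := dist_triangle4 u' u v v'
          rw [dist_comm u' u] at h2
          linarith
        · exact hsep x hx y hy hdisj u hu v hv
  obtain ⟨V, hVc, hVb, hVd, hVs⟩ := key (M + 1) le_rfl
  have hpos : 0 < κ ^ (M + 1) * (L * r) := by positivity
  refine ⟨V '' I, ?_, ?_, ?_, ?_⟩
  · intro x
    obtain ⟨i, hi, a, ha, hxa⟩ := hcov x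
    exact ⟨V a, ⟨a, ⟨i, hi, ha⟩, rfl⟩, hVb a hxa⟩
  · rintro _ ⟨x, hx, rfl⟩
    exact hVc x hx
  · rintro _ ⟨x, hx, rfl⟩ u hu v hv
    have h1 := hVd x u hu
    have h2 := hVd x v hv
    have h3 := dist_triangle_right u v x
    linarith
  · rintro _ ⟨x, ⟨i, hi, hx⟩, rfl⟩ _ ⟨y, hy, rfl⟩ hdisj u hu v hv
    have := hVs i (by omega) x hx y hy hdisj u hu v hv
    rw [hrε]
    linarith

end QuasiArc

/-! ### Simple chains of tiles and their refinement -/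

namespace QuasiArc

open Set Metric

/-- A walk of minimal length has no chords. -/
theorem exists_chordless {α : Type*} {r : α → α → Prop} {x y : α}
    (h : Relation.ReflTransGen r x y) :
    ∃ (n : ℕ) (w : ℕ → α), w 0 = x ∧ w n = y ∧ (∀ k < n, r (w k) (w (k + 1))) ∧
      ∀ i j, i < j → j ≤ n → r (w i) (w j) → j = i + 1 := by
  classical
  have hex : ∃ (n : ℕ) (w : ℕ → α), w 0 = x ∧ w n = y ∧ ∀ k < n, r (w k) (w (k + 1)) := by
    induction h with
    | refl => exact ⟨0, fun _ => x, rfl, rfl, by simp⟩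
    | @tail b c _ hbc ih =>
      obtain ⟨n, w, h0, hn, hw⟩ := ih
      refine ⟨n + 1, fun k => if k ≤ n then w k else c, by simpa using h0, by simp, ?_⟩
      intro k hk
      rcases Nat.lt_succ_iff_lt_or_eq.1 hk with h | rfl
      · simpa [h.le, Nat.succ_le_of_lt h] using hw k h
      · simpa [hn] using hbc
  obtain ⟨w, h0, hn, hw⟩ := Nat.find_spec hex
  refine ⟨Nat.find hex, w, h0, hn, hw, fun i j hij hj hr => ?_⟩
  by_contra hne
  set n := Nat.find hex with hndef
  refine Nat.find_min hex (m := n - (j - i - 1)) (by omega)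
    ⟨fun k => if k ≤ i then w k else w (k + (j - i - 1)), by simpa using h0, ?_, ?_⟩
  · dsimp only
    rw [if_neg (by omega), ← hn]
    congr 1
    omega
  · intro k hk
    dsimp only
    rcases lt_trichotomy k i with h | rfl | h
    · rw [if_pos h.le, if_pos (by omega)]
      exact hw k (by omega)
    · rw [if_pos le_rfl, if_neg (by omega)]
      convert hr using 2
      omega
    · rw [if_neg (by omega), if_neg (by omega)]
      convert hw (k + (j - i - 1)) (by omega) using 2
      omega

/-- `U 0, …, U m` is a simple chain of members of `T` from `a` to `b`. -/
structure IsSimpleChain {X : Type*} (T : Set (Set X)) (a b : X) (m : ℕ) (U : ℕ → Set X) :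
    Prop where
  mem : ∀ i ≤ m, U i ∈ T
  left_mem : a ∈ U 0
  right_mem : b ∈ U m
  meet : ∀ i < m, (U i ∩ U (i + 1)).Nonempty
  eq_succ : ∀ i j, i < j → j ≤ m → (U i ∩ U j).Nonempty → j = i + 1

variable {X : Type*} [MetricSpace X]

theorem IsTiling.dist_chain_le {ε δ : ℝ} {T : Set (Set X)} (hT : IsTiling ε δ T) {a b : X} {m : ℕ}
    {U : ℕ → Set X} (hU : IsSimpleChain T a b m U) (i k : ℕ) (hk : i + k ≤ m) {x y : X}
    (hx : x ∈ U i) (hy : y ∈ U (i + k)) : dist x y ≤ (k + 1) * ε := by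
  induction k generalizing y with
  | zero => simpa using hT.dist_le _ (hU.mem i (by omega)) x hx y hy
  | succ k ih =>
    obtain ⟨z, hz, hz'⟩ := hU.meet (i + k) (by omega)
    have h1 := ih (by omega) hz
    have h2 := hT.dist_le _ (hU.mem _ hk) z hz' y hy
    have h3 := dist_triangle x z y
    push_cast
    linarith

/-- The tiles meeting a connected set form a connected graph. -/
theorem IsTiling.reflTransGen {ε δ : ℝ} (hε : 0 < ε) (hδ : 0 < δ) {T : Set (Set X)}
    (hT : IsTiling ε δ T) {K : Set X} (hK : IsPreconnected K) {V W : Set X} (hV : V ∈ T)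
    (hW : W ∈ T) (hVK : (V ∩ K).Nonempty) (hWK : (W ∩ K).Nonempty) :
    Relation.ReflTransGen
      (fun A B : Set X => B ∈ T ∧ (A ∩ B).Nonempty ∧ (B ∩ K).Nonempty) V W := by
  set r := fun A B : Set X => B ∈ T ∧ (A ∩ B).Nonempty ∧ (B ∩ K).Nonempty with hr
  have hadj : ∀ A ∈ T, ∀ B ∈ T, ∀ x ∈ A, ∀ y ∈ B, y ∈ K → dist x y < δ * ε → r A B := by
    intro A hA B hB x hx y hy hyK hxy
    refine ⟨hB, ?_, ⟨y, hy, hyK⟩⟩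
    by_contra h
    exact absurd (hT.le_dist A hA B hB (disjoint_iff_inter_eq_empty.2
      (not_nonempty_iff_eq_empty.1 h)) x hx y hy) (not_le.2 hxy)
  obtain ⟨x, hxV, hxK⟩ := hVK
  obtain ⟨y, hyW, hyK⟩ := hWK
  -- Both directions are carried because `r` is not symmetric, whereas induction on a preconnected
  -- set needs a symmetric relation.
  have key := hK.induction₂ (fun x y => x ∈ K → y ∈ K → ∀ A ∈ T, ∀ B ∈ T, x ∈ A → y ∈ B →
    Relation.ReflTransGen r A B ∧ Relation.ReflTransGen r B A) (fun x hx => ?_) ?_ ?_ hxK hyK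
  · exact (key hxK hyK V hV W hW hxV hyW).1
  · filter_upwards [mem_nhdsWithin_of_mem_nhds (ball_mem_nhds x (mul_pos hδ hε))] with y hy
    intro hxK hyK A hA B hB hxA hyB
    rw [mem_ball] at hy
    exact ⟨.single (hadj A hA B hB x hxA y hyB hyK (by rwa [dist_comm])),
      .single (hadj B hB A hA y hyB x hxA hxK hy)⟩
  · intro x y z hx hy hz hxy hyz hxK hzK A hA B hB hxA hzB
    obtain ⟨C, hC, hyC⟩ := hT.exists_mem y
    have h1 := hxy hxK hy A hA C hC hxA hyC
    have h2 := hyz hy hzK C hC B hB hyC hzB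
    exact ⟨h1.1.trans h2.1, h2.2.trans h1.2⟩
  · intro x y hx hy h hyK hxK A hA B hB hyA hxB
    exact (h hxK hyK B hB A hA hxB hyA).symm

/-- Along a chain of connected sets `U 0, …, U m` runs a simple chain of tiles, labelled
monotonically by members of the original chain. -/
theorem IsTiling.exists_chain {ε δ : ℝ} (hε : 0 < ε) (hδ : 0 < δ) {T : Set (Set X)}
    (hT : IsTiling ε δ T) {m : ℕ} {U : ℕ → Set X} (hUc : ∀ i ≤ m, IsConnected (U i))
    (hUU : ∀ i < m, (U i ∩ U (i + 1)).Nonempty)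
    (hfar : ∀ i j, i + 1 < j → j ≤ m → ∀ x ∈ U i, ∀ y ∈ U j, 2 * ε < dist x y)
    {a b : X} (ha : a ∈ U 0) (hb : b ∈ U m) :
    ∃ (n : ℕ) (V : ℕ → Set X) (l : ℕ → ℕ), IsSimpleChain T a b n V ∧ Monotone l ∧ l 0 = 0 ∧
      l n = m ∧ (∀ k, l (k + 1) ≤ l k + 1) ∧ ∀ k ≤ n, l k ≤ m ∧ (V k ∩ U (l k)).Nonempty := by
  -- Walking on tiles with labels forces the shortest walk to progress along `U` without turning
  -- back.
  let r : Set X × ℕ → Set X × ℕ → Prop := fun P Q =>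
    Q.1 ∈ T ∧ (P.1 ∩ Q.1).Nonempty ∧ (Q.1 ∩ U Q.2).Nonempty ∧
      P.2 ≤ Q.2 ∧ Q.2 ≤ P.2 + 1 ∧ Q.2 ≤ m
  obtain ⟨A, hA, haA⟩ := hT.exists_mem a
  obtain ⟨B, hB, hbB⟩ := hT.exists_mem b
  have hwalk : ∀ i ≤ m, ∀ V ∈ T, ∀ W ∈ T, (V ∩ U i).Nonempty → (W ∩ U i).Nonempty →
      Relation.ReflTransGen r (V, i) (W, i) := by
    intro i hi V hV W hW hVU hWU
    refine (hT.reflTransGen hε hδ (hUc i hi).isPreconnected hV hW hVU hWU).lift (fun C => (C, i)) ?_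
    rintro C D ⟨h1, h2, h3⟩
    exact ⟨h1, h2, h3, le_rfl, Nat.le_succ _, hi⟩
  have hreach : ∀ i ≤ m, ∀ V ∈ T, (V ∩ U i).Nonempty → Relation.ReflTransGen r (A, 0) (V, i) := by
    intro i
    induction i with
    | zero => exact fun hi V hV hVU => hwalk 0 hi A hA V hV ⟨a, haA, ha⟩ hVU
    | succ i ih =>
      intro hi V hV hVU
      obtain ⟨z, hz, hz'⟩ := hUU i (by omega)
      obtain ⟨C, hC, hzC⟩ := hT.exists_mem z
      refine (ih (by omega) C hC ⟨z, hzC, hz⟩).trans (.head (b := (C, i + 1)) ?_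
        (hwalk (i + 1) hi C hC V hV ⟨z, hzC, hz'⟩ hVU))
      exact ⟨hC, ⟨z, hzC, hzC⟩, ⟨z, hzC, hz'⟩, Nat.le_succ _, le_rfl, hi⟩
  obtain ⟨n, w, h0, hn, hw, hch⟩ := exists_chordless (hreach m le_rfl B hB ⟨b, hbB, hb⟩)
  have hgood : ∀ k ≤ n, (w k).1 ∈ T ∧ (w k).2 ≤ m ∧ ((w k).1 ∩ U (w k).2).Nonempty := by
    intro k hk
    cases k with
    | zero =>
      rw [h0]
      exact ⟨hA, Nat.zero_le _, a, haA, ha⟩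
    | succ k =>
      obtain ⟨h1, -, h2, -, -, h3⟩ := hw k (by omega)
      exact ⟨h1, h3, h2⟩
  have hmono : Monotone fun k => (w (min k n)).2 := by
    refine monotone_nat_of_le_succ fun k => ?_
    rcases lt_or_ge k n with h | h
    · rw [min_eq_left h.le, min_eq_left (Nat.succ_le_of_lt h)]
      exact (hw k h).2.2.2.1
    · rw [min_eq_right h, min_eq_right (by omega)]
  refine ⟨n, fun k => (w k).1, fun k => (w (min k n)).2, ⟨fun i hi => (hgood i hi).1, ?_, ?_,
    fun i hi => (hw i hi).2.1, ?_⟩, hmono, ?_, ?_, fun k => ?_, fun k hk => ?_⟩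
  · simpa [h0] using haA
  · simpa [hn] using hbB
  · intro i j hij hj hmeet
    refine hch i j hij hj ?_
    have hle : (w i).2 ≤ (w j).2 := by
      simpa [hj, hij.le.trans hj] using hmono hij.le
    refine ⟨(hgood j hj).1, hmeet, (hgood j hj).2.2, hle, ?_, (hgood j hj).2.1⟩
    -- If the labels differ by more than one, meeting tiles would bring two far members of `U`
    -- within `2 * ε`. Otherwise the pair is a chord, which minimality of the walk excludes.
    by_contra! hlt
    obtain ⟨x, hx, hxU⟩ := (hgood i (by omega)).2.2
    obtain ⟨y, hy, hyU⟩ := (hgood j hj).2.2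
    obtain ⟨z, hz, hz'⟩ := hmeet
    have h1 := hfar _ _ hlt (hgood j hj).2.1 x hxU y hyU
    have h2 := hT.dist_le _ (hgood i (by omega)).1 x hx z hz
    have h3 := hT.dist_le _ (hgood j hj).1 z hz' y hy
    have h4 := dist_triangle x z y
    linarith
  · simp [h0]
  · simp [hn]
  · dsimp only
    rcases lt_or_ge k n with h | h
    · rw [min_eq_left h.le, min_eq_left (Nat.succ_le_of_lt h)]
      exact (hw k h).2.2.2.2.1
    · rw [min_eq_right h, min_eq_right (by omega)]
      omega
  · dsimp only
    rw [min_eq_left hk]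
    exact (hgood k hk).2

theorem exists_first_reach {l : ℕ → ℕ} (h0 : l 0 = 0) (hl : ∀ k, l (k + 1) ≤ l k + 1) {i n : ℕ}
    (hn : i + 1 ≤ l n) : ∃ s < n, l s = i ∧ l (s + 1) = i + 1 ∧ ∀ k ≤ s, l k ≤ i := by
  classical
  have hex : ∃ k, i + 1 ≤ l k := ⟨n, hn⟩
  have h1 := Nat.find_spec hex
  have h2 : ∀ k < Nat.find hex, l k ≤ i := fun k hk => by
    have := Nat.find_min hex hk
    omega
  have h3 := Nat.find_min' hex hn
  obtain ⟨s, hs⟩ : ∃ s, Nat.find hex = s + 1 := by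
    refine Nat.exists_eq_succ_of_ne_zero fun h => ?_
    rw [h] at h1
    omega
  rw [hs] at h1 h2 h3
  have h4 := h2 s (by omega)
  have h5 := hl s
  exact ⟨s, by omega, by omega, by omega, fun k hk => h2 k (by omega)⟩

/-- A simple chain of at least three tiles is followed by a much finer simple chain of tiles. -/
theorem IsTiling.exists_refinement {ε δ ε' δ' : ℝ} (hε' : 0 < ε') (hδ' : 0 < δ')
    (hεε : 5 * ε' < δ * ε) {T T' : Set (Set X)} (hT : IsTiling ε δ T) (hT' : IsTiling ε' δ' T')
    {a b : X} {m : ℕ} {U : ℕ → Set X} (hU : IsSimpleChain T a b m U) (hm : 2 ≤ m) :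
    ∃ (n : ℕ) (V : ℕ → Set X) (p : ℕ → ℕ), IsSimpleChain T' a b n V ∧ 2 ≤ n ∧ Monotone p ∧
      (∀ j, p j ≤ m) ∧ (∀ i ≤ m, ∃ j < n, p j = i ∧ p (j + 1) = i) ∧
      ∀ j ≤ n, ∀ x ∈ V j, ∃ y ∈ U (p j), dist x y ≤ 2 * ε' := by
  have hfar : ∀ i j, i + 1 < j → j ≤ m → ∀ x ∈ U i, ∀ y ∈ U j, δ * ε ≤ dist x y := by
    intro i j hij hj x hx y hy
    refine hT.le_dist _ (hU.mem i (by omega)) _ (hU.mem j hj) ?_ x hx y hy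
    rw [disjoint_iff_inter_eq_empty, ← not_nonempty_iff_eq_empty]
    intro h
    have := hU.eq_succ i j (by omega) hj h
    omega
  obtain ⟨n, V, l, hV, hl, hl0, hln, hstep, hVU⟩ := hT'.exists_chain hε' hδ'
    (fun i hi => hT.isConnected _ (hU.mem i hi)) hU.meet
    (fun i j hij hj x hx y hy => by linarith [hfar i j hij hj x hx y hy])
    hU.left_mem hU.right_mem
  -- Passing from `U i` to `U (i + 2)` covers a distance of at least `δ * ε`, more than five small
  -- tiles can span, so an interior label lasts for at least four consecutive indices.
  have hinner : ∀ i, i + 2 ≤ m → ∃ s, s + 5 ≤ n ∧ ∀ k, s + 1 ≤ k → k ≤ s + 4 → l k = i + 1 := by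
    intro i hi
    obtain ⟨s, hs, hsi, hsi', -⟩ := exists_first_reach hl0 hstep (i := i) (n := n) (by omega)
    obtain ⟨e, he, hei, hei', hle⟩ :=
      exists_first_reach hl0 hstep (i := i + 1) (n := n) (by omega)
    have hse : s + 4 ≤ e := by
      by_contra! hlt
      have hs1 : s < e := by
        by_contra! h
        have := hl h
        omega
      obtain ⟨x, hx, hxU⟩ := (hVU s (by omega)).2
      obtain ⟨y, hy, hyU⟩ := (hVU (e + 1) (by omega)).2
      rw [hsi] at hxU
      rw [hei'] at hyU
      have h1 := hfar i (i + 1 + 1) (by omega) (by omega) x hxU y hyU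
      obtain ⟨k, hk⟩ : ∃ k, e + 1 = s + k := ⟨e + 1 - s, by omega⟩
      rw [hk] at hy
      have h2 := hT'.dist_chain_le hV s k (by omega) hx hy
      have h3 : (k : ℝ) ≤ 4 := by
        have : k ≤ 4 := by omega
        exact_mod_cast this
      have h4 : ((k : ℝ) + 1) * ε' ≤ 5 * ε' := by gcongr; linarith
      linarith
    refine ⟨s, by omega, fun k hk hk' => ?_⟩
    have h1 := hl hk
    have h2 := hle k (by omega)
    omega
  have hn : 5 ≤ n := by
    obtain ⟨s, hs, -⟩ := hinner 0 (by omega)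
    omega
  have hlm : ∀ j, j ≤ n → l j ≤ m := fun j hj => (hVU j hj).1
  -- The labels `0` and `m` may occur only once in `l`, so the first two and last two values are
  -- overridden. Of the four occurrences of an interior label, the middle two are unaffected.
  obtain ⟨p, hp0, hpm, hpl⟩ : ∃ p : ℕ → ℕ, (∀ j ≤ 1, p j = 0) ∧ (∀ j, n ≤ j + 1 → p j = m) ∧
      ∀ j, 2 ≤ j → j + 1 < n → p j = l j := by
    refine ⟨fun j => if j ≤ 1 then 0 else if n ≤ j + 1 then m else l j, fun j hj => if_pos hj,
      fun j hj => ?_, fun j hj hj' => ?_⟩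
    · dsimp only
      rw [if_neg (by omega), if_pos hj]
    · dsimp only
      rw [if_neg (by omega), if_neg (by omega)]
  have hpcases : ∀ j, (j ≤ 1 ∧ p j = 0) ∨ (2 ≤ j ∧ j + 1 < n ∧ p j = l j) ∨
      (n ≤ j + 1 ∧ p j = m) := by
    intro j
    by_cases h1 : j ≤ 1
    · exact Or.inl ⟨h1, hp0 j h1⟩
    · by_cases h2 : n ≤ j + 1
      · exact Or.inr (Or.inr ⟨h2, hpm j h2⟩)
      · exact Or.inr (Or.inl ⟨by omega, by omega, hpl j (by omega) (by omega)⟩)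
  refine ⟨n, V, p, hV, by omega, ?_, ?_, ?_, ?_⟩
  · intro i j hij
    have h1 := hl hij
    rcases hpcases i with hi | hi | hi <;> rcases hpcases j with hj | hj | hj
    any_goals omega
    have := hlm i (by omega)
    omega
  · intro j
    rcases hpcases j with hj | hj | hj
    · omega
    · have := hlm j (by omega)
      omega
    · omega
  · intro i hi
    rcases Nat.eq_zero_or_pos i with rfl | hi0
    · exact ⟨0, by omega, hp0 _ (by omega), hp0 _ (by omega)⟩
    · rcases hi.eq_or_lt with rfl | him
      · exact ⟨n - 1, by omega, hpm _ (by omega), hpm _ (by omega)⟩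
      · obtain ⟨s, hs, hsl⟩ := hinner (i - 1) (by omega)
        refine ⟨s + 1 + 1, by omega, ?_, ?_⟩
        · rw [hpl _ (by omega) (by omega), hsl _ (by omega) (by omega)]
          omega
        · rw [hpl _ (by omega) (by omega), hsl _ (by omega) (by omega)]
          omega
  · intro j hj x hx
    have hstay : ∀ k ≤ n, (V j ∩ V k).Nonempty → ∃ y ∈ U (l k), dist x y ≤ 2 * ε' := by
      rintro k hk ⟨z, hzj, hzk⟩
      obtain ⟨y, hy, hyU⟩ := (hVU k hk).2
      refine ⟨y, hyU, ?_⟩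
      have h1 := hT'.dist_le _ (hV.mem j hj) x hx z hzj
      have h2 := hT'.dist_le _ (hV.mem k hk) z hzk y hy
      have h3 := dist_triangle x z y
      linarith
    rcases hpcases j with h1 | h1 | h1
    · rw [h1.2.trans hl0.symm]
      refine hstay 0 (by omega) ?_
      obtain rfl | h : j = 0 ∨ j = 0 + 1 := by omega
      · exact ⟨x, hx, hx⟩
      · rw [inter_comm, h]
        exact hV.meet 0 (by omega)
    · rw [h1.2.2]
      exact hstay j hj ⟨x, hx, hx⟩
    · rw [h1.2, ← hln]
      refine hstay n le_rfl ?_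
      rcases hj.eq_or_lt with rfl | hjn
      · exact ⟨x, hx, hx⟩
      · have : n = j + 1 := by omega
        rw [this]
        exact hV.meet j hjn

end QuasiArc

/-! ### Nested subdivisions of the unit interval -/

namespace QuasiArc

open Set Metric

/-- A tower of finite chains `{0, …, m n}` linked by monotone maps, each value of which is attained
at least twice, is the system of index sets of successive subdivisions of `[0, 1]` into intervals:
`idx n t` is the index of the interval of level `n` containing `t`. -/
theorem exists_index {m : ℕ → ℕ} {p : ℕ → ℕ → ℕ} (hp : ∀ n, Monotone (p n))
    (hpm : ∀ n j, p n j ≤ m n)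
    (htwo : ∀ n, ∀ i ≤ m n, ∃ j < m (n + 1), p n j = i ∧ p n (j + 1) = i) :
    ∃ idx : ℕ → ℝ → ℕ, (∀ n, Monotone (idx n)) ∧ (∀ n, idx n 0 = 0) ∧ (∀ n, idx n 1 = m n) ∧
      (∀ n t, idx n t ≤ m n) ∧ (∀ n t, 0 ≤ t → p n (idx (n + 1) t) = idx n t) ∧
      (∀ n, ∃ η > 0, ∀ s t, 0 ≤ s → t - s < η → idx n t ≤ idx n s + 1) ∧
      ∀ s t, 0 ≤ s → s < t → t ≤ 1 → ∃ n, idx n s + 2 ≤ idx n t := by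
  classical
  let fib : ℕ → ℕ → Finset ℕ := fun n i => (Finset.range (m (n + 1) + 1)).filter (p n · = i)
  have hfib : ∀ n, ∀ i ≤ m n, 2 ≤ (fib n i).card := by
    intro n i hi
    obtain ⟨j, hj, h1, h2⟩ := htwo n i hi
    rw [← Finset.card_pair (show j ≠ j + 1 by omega)]
    refine Finset.card_le_card fun k hk => ?_
    simp only [Finset.mem_insert, Finset.mem_singleton] at hk
    simp only [fib, Finset.mem_filter, Finset.mem_range]
    rcases hk with rfl | rfl
    · exact ⟨by omega, h1⟩
    · exact ⟨by omega, h2⟩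
  -- Interval lengths: each interval is divided equally among its at least two children, so lengths
  -- at least halve at each level.
  obtain ⟨w, hw0, hws⟩ : ∃ w : ℕ → ℕ → ℝ, (∀ j, w 0 j = 1 / ((m 0 : ℝ) + 1)) ∧
      ∀ n j, w (n + 1) j = w n (p n j) / (fib n (p n j)).card :=
    ⟨fun n => Nat.rec (fun _ => 1 / ((m 0 : ℝ) + 1))
      (fun n w j => w (p n j) / (fib n (p n j)).card) n, fun _ => rfl, fun _ _ => rfl⟩
  have hw : ∀ n j, 0 < w n j ∧ w n j ≤ (1 / 2) ^ n := by
    intro n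
    induction n with
    | zero =>
      intro j
      rw [hw0]
      refine ⟨by positivity, ?_⟩
      rw [pow_zero, div_le_one (by positivity)]
      linarith [(m 0).cast_nonneg (α := ℝ)]
    | succ n ih =>
      intro j
      have h2 : (2 : ℝ) ≤ (fib n (p n j)).card := by exact_mod_cast hfib n _ (hpm n j)
      obtain ⟨h3, h4⟩ := ih (p n j)
      rw [hws]
      refine ⟨by positivity, ?_⟩
      rw [div_le_iff₀ (by linarith), pow_succ]
      have : (0 : ℝ) < (1 / 2) ^ n := by positivity
      nlinarith
  let B : ℕ → ℕ → ℝ := fun n i => ∑ k ∈ Finset.range i, w n k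
  have hB0 : ∀ n, B n 0 = 0 := fun n => Finset.sum_range_zero _
  have hBs : ∀ n i, B n (i + 1) = B n i + w n i := fun n i => Finset.sum_range_succ _ _
  have hBmono : ∀ n, Monotone (B n) := fun n => monotone_nat_of_le_succ fun i => by
    rw [hBs]
    linarith [(hw n i).1]
  have hBfib : ∀ n, ∀ i ≤ m n + 1,
      B n i = ∑ k ∈ (Finset.range (m (n + 1) + 1)).filter (p n · < i), w (n + 1) k := by
    intro n i hi
    rw [← Finset.sum_fiberwise_of_maps_to (t := Finset.range i) (g := p n) (by
      intro k hk
      simpa using (Finset.mem_filter.1 hk).2)]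
    refine Finset.sum_congr rfl fun j hj => ?_
    have hji := Finset.mem_range.1 hj
    have hset : ((Finset.range (m (n + 1) + 1)).filter (p n · < i)).filter (p n · = j) =
        fib n j := by
      ext k
      simp only [fib, Finset.mem_filter]
      constructor
      · rintro ⟨⟨h1, -⟩, h2⟩
        exact ⟨h1, h2⟩
      · rintro ⟨h1, h2⟩
        exact ⟨⟨h1, by omega⟩, h2⟩
    rw [hset]
    have hcard : (0 : ℝ) < (fib n j).card := by
      have := hfib n j (by omega)
      exact_mod_cast (by omega : 0 < (fib n j).card)
    rw [Finset.sum_congr rfl (g := fun _ => w n j / (fib n j).card), Finset.sum_const,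
      nsmul_eq_mul]
    · field_simp
    · intro k hk
      have : p n k = j := (Finset.mem_filter.1 hk).2
      rw [hws, this]
  have hBle : ∀ n j, j ≤ m (n + 1) → B n (p n j) ≤ B (n + 1) j := by
    intro n j hj
    rw [hBfib n _ ((hpm n j).trans (Nat.le_succ _))]
    refine Finset.sum_le_sum_of_subset_of_nonneg (fun k hk => ?_) fun k _ _ => (hw (n + 1) k).1.le
    rw [Finset.mem_range]
    by_contra! h
    have h1 := hp n h
    have h2 := (Finset.mem_filter.1 hk).2
    omega
  have hleB : ∀ n j, j ≤ m (n + 1) → B (n + 1) (j + 1) ≤ B n (p n j + 1) := by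
    intro n j hj
    rw [hBfib n _ (Nat.succ_le_succ (hpm n j))]
    refine Finset.sum_le_sum_of_subset_of_nonneg (fun k hk => ?_) fun k _ _ => (hw (n + 1) k).1.le
    have hk' := Finset.mem_range.1 hk
    have h1 := hp n (Nat.le_of_lt_succ hk')
    simp only [Finset.mem_filter, Finset.mem_range]
    omega
  have hB1 : ∀ n, B n (m n + 1) = 1 := by
    intro n
    induction n with
    | zero =>
      have h : B 0 (m 0 + 1) = ∑ k ∈ Finset.range (m 0 + 1), 1 / ((m 0 : ℝ) + 1) :=
        Finset.sum_congr rfl fun k _ => hw0 k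
      rw [h, Finset.sum_const, Finset.card_range, nsmul_eq_mul]
      push_cast
      field_simp
    | succ n ih =>
      rw [← ih, hBfib n _ le_rfl, Finset.filter_true_of_mem fun k _ => Nat.lt_succ_of_le (hpm n k)]
  have hptop : ∀ n, p n (m (n + 1)) = m n := by
    intro n
    obtain ⟨j, hj, -, h⟩ := htwo n (m n) le_rfl
    exact le_antisymm (hpm n _) (h ▸ hp n hj)
  -- `B n i` is the left end of interval `i`. Intervals are half-open, except that the cap `m n`
  -- puts `t = 1` in the last one.
  let idx : ℕ → ℝ → ℕ := fun n t => Nat.findGreatest (fun i => B n i ≤ t) (m n)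
  have hidx_le : ∀ n t, idx n t ≤ m n := fun n t => Nat.findGreatest_le _
  have hidx_spec : ∀ n t, 0 ≤ t → B n (idx n t) ≤ t := fun n t ht =>
    Nat.findGreatest_spec (P := fun i => B n i ≤ t) (Nat.zero_le _) (by simpa [hB0] using ht)
  have hidx_lt : ∀ n t, idx n t < m n → t < B n (idx n t + 1) := fun n t h =>
    not_le.1 (Nat.findGreatest_is_greatest (P := fun i => B n i ≤ t) (Nat.lt_succ_self _) h)
  have hidx_eq : ∀ n t i, i ≤ m n → B n i ≤ t → (i < m n → t < B n (i + 1)) → idx n t = i := by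
    intro n t i hi h1 h2
    refine Nat.findGreatest_eq_iff.2 ⟨hi, fun _ => h1, fun j hij hj => not_le.2 ?_⟩
    exact (h2 (by omega)).trans_le (hBmono n hij)
  have hmono : ∀ n, Monotone (idx n) := fun n s t hst =>
    Nat.findGreatest_mono_left (fun i hi => le_trans hi hst) _
  refine ⟨idx, hmono, fun n => ?_, fun n => ?_, hidx_le, fun n t ht => ?_, fun n => ?_, ?_⟩
  · refine hidx_eq n 0 0 (Nat.zero_le _) (hB0 n).le fun _ => ?_
    rw [hBs, hB0, zero_add]
    exact (hw n 0).1
  · refine hidx_eq n 1 (m n) le_rfl ?_ fun h => absurd h (lt_irrefl _)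
    rw [← hB1 n]
    exact hBmono n (Nat.le_succ _)
  · refine (hidx_eq n t _ (hpm n _) ((hBle n _ (hidx_le _ _)).trans (hidx_spec _ t ht))
      fun h => ?_).symm
    refine (hidx_lt (n + 1) t ?_).trans_le (hleB n _ (hidx_le _ _))
    refine lt_of_le_of_ne (hidx_le _ _) fun h' => ?_
    rw [h', hptop] at h
    exact lt_irrefl _ h
  · obtain ⟨i₀, -, hi₀⟩ := (Finset.range (m n + 1)).exists_min_image (w n) ⟨0, by simp⟩
    refine ⟨w n i₀, (hw n i₀).1, fun s t hs hst => ?_⟩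
    by_contra! hlt
    have h1 := hidx_le n t
    have h2 := hidx_lt n s (by omega)
    have hst' : s ≤ t := by
      by_contra! h
      have := hmono n h.le
      omega
    have h3 := (hBmono n (show idx n s + 1 + 1 ≤ idx n t by omega)).trans
      (hidx_spec n t (hs.trans hst'))
    rw [hBs] at h3
    have h4 := hi₀ (idx n s + 1) (by simp; omega)
    linarith
  · intro s t hs hst ht
    obtain ⟨n, hn⟩ := exists_pow_lt_of_lt_one (show (0 : ℝ) < (t - s) / 2 by linarith)
      (show (1 / 2 : ℝ) < 1 by norm_num)
    refine ⟨n, ?_⟩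
    by_contra! hlt
    have h1 : t ≤ B n (idx n t + 1) := by
      rcases (hidx_le n t).eq_or_lt with h | h
      · rw [h, hB1]
        exact ht
      · exact (hidx_lt n t h).le
    have h2 := h1.trans (hBmono n (show idx n t + 1 ≤ idx n s + 1 + 1 by omega))
    rw [hBs, hBs] at h2
    have h3 := hidx_spec n s hs
    have h4 := (hw n (idx n s)).2
    have h5 := (hw n (idx n s + 1)).2
    linarith

end QuasiArc

/-! ### The limit arc and its turning -/

namespace QuasiArc

open Set Metric Filter Topology

/-- The limit of a tower of ever finer simple chains, each following the preceding one, is an arc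
whose turning at each scale is controlled. -/
theorem exists_limit_arc {X : Type*} [MetricSpace X] [CompleteSpace X] {ε ρ δ : ℝ} (hε : 0 < ε)
    (hρ : 0 < ρ) (hρδ : ρ ≤ δ / 48) (hδ : δ ≤ 1) {T : ℕ → Set (Set X)}
    (hT : ∀ n, IsTiling (ρ ^ n * ε) δ (T n)) {a b : X} {m : ℕ → ℕ} {U : ℕ → ℕ → Set X}
    (hU : ∀ n, IsSimpleChain (T n) a b (m n) (U n)) {p : ℕ → ℕ → ℕ} (hp : ∀ n, Monotone (p n))
    (hpm : ∀ n j, p n j ≤ m n)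
    (htwo : ∀ n, ∀ i ≤ m n, ∃ j < m (n + 1), p n j = i ∧ p n (j + 1) = i)
    (hnear : ∀ n, ∀ j ≤ m (n + 1), ∀ x ∈ U (n + 1) j, ∃ y ∈ U n (p n j),
      dist x y ≤ 2 * (ρ ^ (n + 1) * ε)) :
    ∃ f : unitInterval → X, IsEmbedding f ∧ f 0 = a ∧ f 1 = b ∧
      (∀ t, ∃ i ≤ m 0, ∃ y ∈ U 0 i, dist (f t) y ≤ ε) ∧
      ∀ n, ∀ s t : unitInterval, ∀ u ∈ uIcc s t, dist (f s) (f t) ≤ δ * (ρ ^ n * ε) / 2 →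
        dist (f u) (f s) ≤ 3 * (ρ ^ n * ε) := by
  obtain ⟨idx, hmono, hidx0, hidx1, hidxm, hidxp, hclose, hsep⟩ := exists_index hp hpm htwo
  have hX : Nonempty X := ⟨a⟩
  have hεn : ∀ n, 0 < ρ ^ n * ε := fun n => by positivity
  choose! g hg using fun n i (hi : i ≤ m n) => ((hT n).isConnected _ ((hU n).mem i hi)).nonempty
  have hstep : ∀ (t : unitInterval) n,
      dist (g n (idx n t)) (g (n + 1) (idx (n + 1) t)) ≤ 2 * ε * ρ ^ n := by
    intro t n
    obtain ⟨y, hy, hgy⟩ := hnear n _ (hidxm (n + 1) t) _ (hg (n + 1) _ (hidxm (n + 1) t))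
    rw [hidxp n t t.2.1] at hy
    have h1 := (hT n).dist_le _ ((hU n).mem _ (hidxm n t)) _ (hg n _ (hidxm n t)) y hy
    have h2 := dist_triangle_right (g n (idx n t)) (g (n + 1) (idx (n + 1) t)) y
    rw [pow_succ] at hgy
    nlinarith [hεn n]
  choose f hf using fun t : unitInterval => cauchySeq_tendsto_of_complete
    (cauchySeq_of_le_geometric ρ (2 * ε) (by linarith) (hstep t))
  -- One refinement costs `2 * (ρ ^ (n + 1) * ε)` and the tail of the series at most `4 * (ρ ^ (n +
  -- 1) * ε)`; as `ρ ≤ δ / 48`, the sum is at most an eighth of the gap.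
  have hfU : ∀ n (t : unitInterval), ∃ y ∈ U n (idx n t), dist (f t) y ≤ δ * (ρ ^ n * ε) / 8 := by
    intro n t
    obtain ⟨y, hy, hgy⟩ := hnear n _ (hidxm (n + 1) t) _ (hg (n + 1) _ (hidxm (n + 1) t))
    rw [hidxp n t t.2.1] at hy
    refine ⟨y, hy, ?_⟩
    have h1 := dist_le_of_le_geometric_of_tendsto ρ (2 * ε) (by linarith) (hstep t) (hf t) (n + 1)
    have h2 : 2 * ε * ρ ^ (n + 1) / (1 - ρ) ≤ 4 * (ρ ^ (n + 1) * ε) := by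
      rw [div_le_iff₀ (by linarith)]
      nlinarith [hεn (n + 1)]
    have h3 := dist_triangle_left (f t) y (g (n + 1) (idx (n + 1) t))
    have h4 : ρ ^ (n + 1) * ε ≤ δ / 48 * (ρ ^ n * ε) := by
      rw [pow_succ, mul_comm (ρ ^ n), mul_assoc]
      exact mul_le_mul_of_nonneg_right hρδ (hεn n).le
    linarith
  have hδn : ∀ n, δ * (ρ ^ n * ε) ≤ ρ ^ n * ε := fun n => by nlinarith [hεn n]
  have hdist : ∀ n (s t : unitInterval), idx n s ≤ idx n t + 1 → idx n t ≤ idx n s + 1 →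
      dist (f s) (f t) ≤ 3 * (ρ ^ n * ε) := by
    intro n s t hst hts
    obtain ⟨y, hy, hfy⟩ := hfU n s
    obtain ⟨z, hz, hfz⟩ := hfU n t
    obtain ⟨x, hxs, hxt⟩ : (U n (idx n s) ∩ U n (idx n t)).Nonempty := by
      have hs := hidxm n s
      have ht := hidxm n t
      obtain h | h | h : idx n s = idx n t ∨ idx n s = idx n t + 1 ∨ idx n t = idx n s + 1 := by
        omega
      · rw [h, inter_self]
        exact ⟨z, hz⟩
      · rw [h, inter_comm]
        exact (hU n).meet _ (by omega)
      · rw [h]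
        exact (hU n).meet _ (by omega)
    have h1 := (hT n).dist_le _ ((hU n).mem _ (hidxm n s)) y hy x hxs
    have h2 := (hT n).dist_le _ ((hU n).mem _ (hidxm n t)) x hxt z hz
    have h3 := dist_triangle4 (f s) y z (f t)
    have h4 := dist_triangle y x z
    rw [dist_comm z] at h3
    linarith [hδn n, hεn n]
  -- The tiles are then within `1/2 + 1/8 + 1/8 < 1` times the gap, so they meet, and simplicity of
  -- the chain bounds the indices.
  have hindex : ∀ n (s t : unitInterval), dist (f s) (f t) ≤ δ * (ρ ^ n * ε) / 2 → idx n t ≤ idx n s + 1 := by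
    intro n s t hst
    by_contra! hlt
    obtain ⟨y, hy, hfy⟩ := hfU n s
    obtain ⟨z, hz, hfz⟩ := hfU n t
    have h1 : Disjoint (U n (idx n s)) (U n (idx n t)) := by
      rw [disjoint_iff_inter_eq_empty, ← not_nonempty_iff_eq_empty]
      intro h
      have := (hU n).eq_succ _ _ (by omega) (hidxm n t) h
      omega
    have h2 := (hT n).le_dist _ ((hU n).mem _ (hidxm n s)) _ ((hU n).mem _ (hidxm n t)) h1 y hy z hz
    have h3 := dist_triangle4 y (f s) (f t) z
    rw [dist_comm y (f s)] at h3
    have : 0 < δ * (ρ ^ n * ε) := mul_pos (by linarith) (hεn n)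
    linarith
  have hlim : Tendsto (fun n => 2 * (ρ ^ n * ε)) atTop (𝓝 0) := by
    have := ((tendsto_pow_atTop_nhds_zero_of_lt_one hρ.le (by linarith)).mul_const ε).const_mul 2
    simpa using this
  have heq : ∀ (t : unitInterval) x, (∀ n, x ∈ U n (idx n t)) → f t = x := by
    intro t x hx
    refine dist_le_zero.1 (ge_of_tendsto' hlim fun n => ?_)
    obtain ⟨y, hy, hfy⟩ := hfU n t
    have h1 := (hT n).dist_le _ ((hU n).mem _ (hidxm n t)) y hy x (hx n)
    have h2 := dist_triangle (f t) y x
    linarith [hδn n, hεn n]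
  have hinj' : ∀ s t : unitInterval, s < t → f s ≠ f t := by
    intro s t hst heq
    obtain ⟨n, hn⟩ := hsep s t s.2.1 hst t.2.2
    have := hindex n s t (by
      rw [heq, dist_self]
      have : 0 < δ * (ρ ^ n * ε) := mul_pos (by linarith) (hεn n)
      linarith)
    omega
  have hinj : Function.Injective f := by
    intro s t hst
    by_contra hne
    rcases lt_or_gt_of_ne hne with h | h
    · exact hinj' s t h hst
    · exact hinj' t s h hst.symm
  have hcont : Continuous f := by
    refine Metric.continuous_iff.2 fun t e he => ?_
    have hlim' : Tendsto (fun n => 3 * (ρ ^ n * ε)) atTop (𝓝 0) := by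
      simpa using ((tendsto_pow_atTop_nhds_zero_of_lt_one hρ.le
        (by linarith)).mul_const ε).const_mul 3
    obtain ⟨n, hn⟩ := (hlim'.eventually_lt_const he).exists
    obtain ⟨η, hη, hcl⟩ := hclose n
    refine ⟨η, hη, fun s hs => (hdist n s t ?_ ?_).trans_lt hn⟩
    all_goals
      rw [Subtype.dist_eq, Real.dist_eq, abs_lt] at hs
    · exact hcl t s t.2.1 hs.2
    · exact hcl s t s.2.1 (by linarith)
  refine ⟨f, (hcont.isClosedEmbedding hinj).isEmbedding, heq 0 a fun n => ?_, heq 1 b fun n => ?_,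
    fun t => ?_, ?_⟩
  · rw [Icc.coe_zero, hidx0]
    exact (hU n).left_mem
  · rw [Icc.coe_one, hidx1]
    exact (hU n).right_mem
  · obtain ⟨y, hy, hfy⟩ := hfU 0 t
    have := hδn 0
    rw [pow_zero, one_mul] at hfy this
    exact ⟨_, hidxm 0 t, y, hy, by linarith⟩
  · intro n s t u hu hst
    have h1 := hindex n s t hst
    have h2 := hindex n t s (by rwa [dist_comm])
    rcases mem_uIcc.1 hu with h | h
    · have h3 := hmono n (show (s : ℝ) ≤ u from h.1)
      have h4 := hmono n (show (u : ℝ) ≤ t from h.2)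
      exact hdist n u s (by omega) (by omega)
    · have h3 := hmono n (show (t : ℝ) ≤ u from h.1)
      have h4 := hmono n (show (u : ℝ) ≤ s from h.2)
      exact hdist n u s (by omega) (by omega)

/-- The two summands of the constant treat points at distance above and below the coarsest gap
scale: above it the size of the whole arc suffices, below it the turning bound at the matching
level. -/
theorem exists_quasiArc {L : ℝ} {X : Type*} [MetricSpace X] [CompleteSpace X]
    (hX : IsLinearlyConnected L X) {δ : ℝ} (hδ0 : 0 < δ) (hδ : δ ≤ 1)
    (htil : ∀ ε : ℝ, 0 < ε → ∃ T : Set (Set X), IsTiling ε δ T) {a b : X} (hab : a ≠ b)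
    {ρ : ℝ} (hρ : 0 < ρ) (hρδ : ρ ≤ δ / 48) :
    ∃ J : EmbeddedArc X, J.Joins a b ∧
      J.IsQuasiArc ((10 + 6 * L) / δ + 12 / (ρ * δ)) := by
  -- Two tiles span at most `2 * ε`, so the first chain has at least three, as refinement requires.
  obtain ⟨ε, hε, hdab⟩ : ∃ ε : ℝ, 0 < ε ∧ dist a b = 3 * ε :=
    ⟨dist a b / 3, by have := dist_pos.2 hab; positivity, by ring⟩
  have hεn : ∀ n, 0 < ρ ^ n * ε := fun n => by positivity
  choose T hT using fun n : ℕ => htil (ρ ^ n * ε) (hεn n)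
  have hT0 : IsTiling ε δ (T 0) := by simpa using hT 0
  obtain ⟨K, hK, haK, hbK, hKd⟩ := exists_connected_of_dist hX a b
  obtain ⟨m₀, U₀, l, hU₀, -, -, -, -, hlU⟩ := hT0.exists_chain hε hδ0 (m := 0) (U := fun _ => K)
    (fun _ _ => hK) (by simp) (by omega) haK hbK
  have hm₀ : 2 ≤ m₀ := by
    by_contra! h
    have h1 := hT0.dist_chain_le hU₀ 0 m₀ (by omega) hU₀.left_mem
      (by simpa using hU₀.right_mem)
    have h2 : (m₀ : ℝ) ≤ 1 := by exact_mod_cast Nat.le_of_lt_succ h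
    nlinarith
  have hrec : ∀ n (c : ℕ × (ℕ → Set X)), IsSimpleChain (T n) a b c.1 c.2 ∧ 2 ≤ c.1 →
      ∃ (c' : ℕ × (ℕ → Set X)) (p : ℕ → ℕ),
        (IsSimpleChain (T (n + 1)) a b c'.1 c'.2 ∧ 2 ≤ c'.1) ∧ Monotone p ∧
        (∀ j, p j ≤ c.1) ∧ (∀ i ≤ c.1, ∃ j < c'.1, p j = i ∧ p (j + 1) = i) ∧
        ∀ j ≤ c'.1, ∀ x ∈ c'.2 j, ∃ y ∈ c.2 (p j), dist x y ≤ 2 * (ρ ^ (n + 1) * ε) := by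
    rintro n ⟨m, U⟩ ⟨hU, hm⟩
    obtain ⟨m', U', p, h1, h2, h3⟩ := (hT n).exists_refinement (hεn (n + 1)) hδ0 (by
      rw [pow_succ]
      nlinarith [hεn n]) (hT (n + 1)) hU hm
    exact ⟨(m', U'), p, ⟨h1, h2⟩, h3⟩
  choose! F P hF hPmono hPm hPtwo hPnear using hrec
  let c : ℕ → ℕ × (ℕ → Set X) := fun n => Nat.rec (m₀, U₀) F n
  have hc : ∀ n, IsSimpleChain (T n) a b (c n).1 (c n).2 ∧ 2 ≤ (c n).1 := by
    intro n
    induction n with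
    | zero => exact ⟨hU₀, hm₀⟩
    | succ n ih => exact hF n _ ih
  obtain ⟨f, hf, hfa, hfb, hf0, hturn⟩ := exists_limit_arc hε hρ hρδ hδ hT (fun n => (hc n).1)
    (p := fun n => P n (c n)) (fun n => hPmono n _ (hc n)) (fun n => hPm n _ (hc n))
    (fun n => hPtwo n _ (hc n)) (fun n => hPnear n _ (hc n))
  have hfK : ∀ t, ∃ y ∈ K, dist (f t) y ≤ 2 * ε := by
    intro t
    obtain ⟨i, hi, y, hy, hty⟩ := hf0 t
    obtain ⟨z, hz, hzK⟩ := (hlU i hi).2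
    have h1 := hT0.dist_le _ (hU₀.mem i hi) y hy z hz
    have h2 := dist_triangle (f t) y z
    exact ⟨z, hzK, by linarith⟩
  have hL : 0 ≤ L * (3 * ε) := by
    rw [← hdab]
    exact dist_nonneg.trans (hKd a haK a haK)
  have hLL : 0 ≤ L := nonneg_of_mul_nonneg_left hL (by positivity)
  have hsize : ∀ s t, dist (f s) (f t) ≤ (4 + 3 * L) * ε := by
    intro s t
    obtain ⟨y, hy, hsy⟩ := hfK s
    obtain ⟨z, hz, htz⟩ := hfK t
    have h1 := hKd y hy z hz
    have h2 := dist_triangle4 (f s) y z (f t)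
    rw [hdab] at h1
    rw [dist_comm z] at h2
    linarith
  refine ⟨⟨f, hf⟩, ⟨hfa, hfb⟩, ?_⟩
  rintro _ ⟨s, rfl⟩ _ ⟨t, rfl⟩
  change diam (EmbeddedArc.subarc ⟨f, hf⟩ (f s) (f t)) ≤ _ * dist (f s) (f t)
  have hsub : EmbeddedArc.subarc ⟨f, hf⟩ (f s) (f t) ⊆ f '' uIcc s t := by
    rintro _ ⟨s', t', u, hs, ht, hu, rfl⟩
    obtain rfl := hf.injective hs
    obtain rfl := hf.injective ht
    exact ⟨u, hu, rfl⟩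
  have hdiam : ∀ C, 0 ≤ C → (∀ u ∈ uIcc s t, ∀ v ∈ uIcc s t, dist (f u) (f v) ≤ C) →
      diam (EmbeddedArc.subarc ⟨f, hf⟩ (f s) (f t)) ≤ C := by
    intro C hC h
    refine diam_le_of_forall_dist_le hC fun x hx y hy => ?_
    obtain ⟨u, hu, rfl⟩ := hsub hx
    obtain ⟨v, hv, rfl⟩ := hsub hy
    exact h u hu v hv
  set d := dist (f s) (f t) with hd
  have hd0 : 0 ≤ d := dist_nonneg
  rw [add_mul]
  have hpos1 : 0 ≤ (10 + 6 * L) / δ * d := by positivity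
  have hpos2 : 0 ≤ 12 / (ρ * δ) * d := by positivity
  rcases hd0.eq_or_lt with h0 | hdpos
  · obtain rfl := hf.injective (dist_eq_zero.1 (hd.symm.trans h0.symm))
    refine (hdiam 0 le_rfl fun u hu v hv => ?_).trans (by linarith)
    rw [uIcc_self, mem_singleton_iff] at hu hv
    rw [hu, hv, dist_self]
  rcases le_or_gt d (δ * ε / 2) with hsmall | hlarge
  -- The finest level at which the turning bound still applies; failure at level `n + 1` bounds `ρ ^
  -- n * ε` by a multiple of `d`.
  · obtain ⟨n, hn, hn'⟩ := exists_nat_pow_near_of_lt_one (x := d / (δ * ε / 2)) (y := ρ)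
      (by positivity) ((div_le_one (by positivity)).2 hsmall) hρ (by linarith)
    rw [lt_div_iff₀ (by positivity)] at hn
    rw [div_le_iff₀ (by positivity)] at hn'
    have hdn : d ≤ δ * (ρ ^ n * ε) / 2 := by linarith
    have hle : 6 * (ρ ^ n * ε) ≤ 12 / (ρ * δ) * d := by
      rw [div_mul_eq_mul_div, le_div_iff₀ (by positivity)]
      rw [pow_succ] at hn
      linarith
    refine (hdiam (6 * (ρ ^ n * ε)) (by positivity) fun u hu v hv => ?_).trans (by linarith)
    have h1 := hturn n s t u hu hdn
    have h2 := hturn n s t v hv hdn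
    have h3 := dist_triangle_right (f u) (f v) (f s)
    linarith
  · have hle : (4 + 3 * L) * ε ≤ (10 + 6 * L) / δ * d := by
      rw [div_mul_eq_mul_div, le_div_iff₀ (by positivity)]
      nlinarith
    exact (hdiam _ (by positivity) fun u _ v _ => hsize u v).trans (by linarith)

end QuasiArc

theorem corollary1p2 (L : ℝ) (hL : 1 ≤ L) (N : ℕ) :
    ∃ lam : ℝ, 1 ≤ lam ∧
      ∀ (X : Type*) [MetricSpace X] [CompleteSpace X],
        IsLinearlyConnected L X → IsMetricDoubling N X →
          ∀ a b : X, a ≠ b →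
            ∃ J : EmbeddedArc X, J.Joins a b ∧ J.IsQuasiArc lam := by
  obtain ⟨δ, hδ0, hδ, htil⟩ := QuasiArc.exists_tiling L hL N
  refine ⟨(10 + 6 * L) / δ + 12 / (δ / 48 * δ), ?_, fun X _ _ hX hN a b hab =>
    QuasiArc.exists_quasiArc hX hδ0 hδ (htil X hX hN) hab (by positivity) le_rfl⟩
  have h1 : 1 ≤ (10 + 6 * L) / δ := by
    rw [le_div_iff₀ hδ0]
    linarith
  have h2 : 0 ≤ 12 / (δ / 48 * δ) := by positivity
  linarith
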